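/- **Hyperlogarithms.** A word of weight $w(i)=m$ is a tuple $i=[i_1|\dots|i_m]$ with $i_k\in\{0,1\}$; its length $l(i)$ is the number of its nonzero components. Put $\omega_0(t)=1/t$, $\omega_1(t)=1/(1-t)$, and for words ending in $1$ define $L_{\varnothing}=1$, $L_{[i_1|\dots|i_m]}(x)=\int_0^x \omega_{i_1}(t)\,L_{[i_2|\dots|i_m]}(t)\,dt$. Let $I_m$ be the set of words of weight $m$ with $i_m=1$ ($I_0=\emptyset$). A word $i$ is *admissible* if $i_k=1$ for all $k\equiv w(i) \pmod 2$; $\mathscr{I}_m$ is the set of admissible words of weight $m$. **Partial integrals.** Let $G_1=1$, and for $l\ge 1$ $$G_{l+1}(y,x)=\int_0^y \frac{G_l(1,t)}{1-tx}\,dt \ \ (l \text{ odd}),\qquad G_{l+1}(y,x)=\int_0^y \frac{t x\,G_l(1,t)}{1-tx}\,dt\ \ (l\text{ even}).$$ **Coefficients.** With $\zeta(m_1,\dots,m_r)=\sum_{0<k_1<\dots<k_r}\prod_j k_j^{-m_j}$, let $\psi_0=1$ and, for $n\ge1$, let $\psi_{2n}$ be the sum of all $\zeta(m_1,\dots,m_r)$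 with $m_1+\dots+m_r=2n$, $m_r=2$, $1\le m_k\le 2$ for $k<r$, and such that the word $[0^{m_r-1}|1|\dots|0^{m_1-1}|1]$ is admissible. Let $\beta^{(2)}_1=1$ and, for $l\ge2$, $1\le m\le l$, $m\equiv l\pmod 2$, $$\beta^{(l+1)}_m=\sum_{\substack{0\le n\le l-m\\ n \text{ even}}}\psi_n\,\beta^{(l)}_{m-1+n},$$ with $\beta^{(l+1)}_m=0$ for all other $m$ (in particular for $m=0$ and for $m\not\equiv l \pmod 2$). For $i\in I_m$ let $X(i)=\{a\in\{0,1\}^{m-1} : a_k=1 \text{ whenever } i_k=1,\ 1\le k\le m-1\}$. Let $\alpha^{(2)}_{[1]}=1$, $\alpha^{(2)}_{[i]}=0$ for every other word, and for $l\ge2$ and $i\in I_m$ $$\alpha^{(l+1)}_{[i]}=\sum_{n=2}^{l-m}\ \sum_{b\in I_n,\ b_1=0}L_{[b]}(1)\sum_{a\in X(i)}(-1)^{w(a)-l(a)}\alpha^{(l)}_{[a|b]}+\sum_{a\in X(i)\cap I_{m-1}}(-1)^{w(a)-l(a)}\alpha^{(l)}_{[a]} .$$ **Proposition.** Let $l\ge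 1$. For every $x\in(0,1)$ the integral defining $G_{l+1}(1,x)$ converges absolutely, and $$G_{l+1}(1,x)=\begin{cases}\dfrac1x\displaystyle\sum_{m=1}^l\beta^{(l+1)}_m\sum_{i\in\mathscr{I}_m}L_{[i]}(x), & l\text{ odd},\\[2mm] \displaystyle\sum_{m=1}^l\beta^{(l+1)}_m\sum_{i\in\mathscr{I}_m}L_{[i]}(x), & l\text{ even}.\end{cases}$$ Likewise $G_{l+1}(1,x)=\sum_{m=1}^l\sum_{i\in I_m}\alpha^{(l+1)}_{[i]}L_{[i]}(x)$ for $l$ even, with an extra factor $\frac1x$ in front of the sum for $l$ odd. For all $1\le m\le l$ and $i\in I_m$, $\alpha^{(l+1)}_{[i]}=\beta^{(l+1)}_m$ if $i$ is admissible and $\alpha^{(l+1)}_{[i]}=0$ otherwise; so the coefficient of $L_{[i]}$ depends only on the weight for admissible words and vanishes for non-admissible words. -/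

import Mathlib

open scoped BigOperators

noncomputable section

namespace IterInt

/-- Words in the letters `0` (for `dz/z`) and `1` (for `dz/(1-z)`); the leftmost letter is the
outermost one in the iterated integral. The weight of a word is `List.length`. -/
abbrev Word := List (Fin 2)

/-- The length `l(i)` of a word: the number of its nonzero components. -/
def len (i : Word) : ℕ := i.count 1

/-- All `2 ^ m` words of weight `m`. -/
def words (m : ℕ) : Finset Word :=
  (Finset.univ : Finset (Fin m → Fin 2)).image List.ofFn

/-- `i` is admissible if `i_k = 1` for all `k ≡ w(i)` mod `2`
(components are numbered from `1`, list entries from `0`). -/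
def Admissible (i : Word) : Prop :=
  ∀ k < i.length, (k + 1) % 2 = i.length % 2 → i[k]? = some 1

instance : DecidablePred Admissible := fun i => by
  unfold Admissible; infer_instance

/-- The admissible words of weight `m`. -/
def admWords (m : ℕ) : Finset Word := (words m).filter Admissible

/-- The words of weight `m` whose last letter is `1` (empty for `m = 0`). -/
def endWords (m : ℕ) : Finset Word := (words m).filter fun i => i.getLast? = some 1

/-- The words of weight `w(i) - 1` that have a `1` wherever `i` has one. -/
def X (i : Word) : Finset Word :=
  (words (i.length - 1)).filter fun a => ∀ k < i.length - 1, i[k]? = some 1 → a[k]? = some 1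

/-- The form attached to a letter: `1/t` for `0` and `1/(1-t)` for `1`. -/
def form (a : Fin 2) (t : ℝ) : ℝ := if a = 0 then 1 / t else 1 / (1 - t)

/-- The hyperlogarithm `L_[i](x)`, the iterated integral from `0` to `x`. -/
def L : Word → ℝ → ℝ
  | [], _ => 1
  | a :: w, x => ∫ t in (0 : ℝ)..x, form a t * L w t

/-- `ζ(m_1, …, m_r) = ∑_{0 < k_1 < ⋯ < k_r} 1 / (k_1 ^ m_1 ⋯ k_r ^ m_r)`. -/
def multiZeta {r : ℕ} (m : Fin r → ℕ) : ℝ :=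
  ∑' k : {k : Fin r → ℕ // StrictMono k ∧ ∀ j, 0 < k j}, ∏ j, 1 / ((k.1 j : ℝ) ^ m j)

/-- The word `[0^{m_r-1} | 1 | … | 0^{m_1-1} | 1]` of `(m_1, …, m_r)`. -/
def zetaWord (m : List ℕ) : Word :=
  m.reverse.flatMap fun a => List.replicate (a - 1) 0 ++ [1]

/-- `psi n` is `ψ_{2n}`: `ψ_0 = 1`, and for `n ≥ 1` the sum of all `ζ(m_1, …, m_r)` with
`m_1 + ⋯ + m_r = 2n`, `m_r = 2`, `1 ≤ m_k ≤ 2`, and with admissible word. -/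
def psi (n : ℕ) : ℝ :=
  if n = 0 then 1 else
    ∑ c : Composition (2 * n) with
        c.blocks.getLast? = some 2 ∧ (∀ b ∈ c.blocks, b ≤ 2) ∧ Admissible (zetaWord c.blocks),
      multiZeta c.blocksFun

/-- `beta l m` is `β^{(l)}_m`: `β^{(2)}_1 = 1` and, for `l ≥ 2`, `1 ≤ m ≤ l`, `m ≡ l` mod `2`,
`β^{(l+1)}_m = ∑_{0 ≤ n ≤ l - m, n even} ψ_n β^{(l)}_{m-1+n}`; all other values are `0`. -/
def beta : ℕ → ℕ → ℝ
  | 0, _ => 0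
  | 1, _ => 0
  | 2, m => if m = 1 then 1 else 0
  | l + 3, m =>
    if 1 ≤ m ∧ m ≤ l + 2 ∧ m % 2 = (l + 2) % 2 then
      ∑ n ∈ Finset.range ((l + 2 - m) / 2 + 1), psi n * beta (l + 2) (m - 1 + 2 * n)
    else 0

/-- The factor by which `G_l(1,t)` is multiplied before integrating in `t`. -/
def kernel (l : ℕ) (t x : ℝ) : ℝ :=
  if Even l then t * x / (1 - t * x) else 1 / (1 - t * x)

/-- `G l y x` is `G_l(y, x)`, with `G_1 = 1` and `G_{l+1}(y, x)` the primitive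
`∫_0^y kernel l t x * G_l(1,t) dt` for `l ≥ 1` (the index `0` is not used). -/
def G : ℕ → ℝ → ℝ → ℝ
  | 0, _, _ => 1
  | 1, _, _ => 1
  | l + 2, y, x => ∫ t in (0 : ℝ)..y, kernel (l + 1) t x * G (l + 1) 1 t

/-- `alpha l i` is the coefficient `α^{(l)}_[i]` of `L_[i]`, given by `α^{(2)}_[1] = 1` and the
recursion that computes `G_{l+1}(1, ·)` from `G_l(1, ·)`. -/
def alpha : ℕ → Word → ℝ
  | 0, _ => 0
  | 1, _ => 0
  | 2, i => if i = [1] then 1 else 0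
  | l + 3, i =>
    (∑ n ∈ Finset.Icc 2 (l + 2 - i.length),
      ∑ b ∈ endWords n with b.head? = some 0,
        L b 1 * ∑ a ∈ X i, (-1) ^ (a.length - len a) * alpha (l + 2) (a ++ b)) +
    ∑ a ∈ X i ∩ endWords (i.length - 1), (-1) ^ (a.length - len a) * alpha (l + 2) a

end IterInt

end

noncomputable section

namespace IterInt

open MeasureTheory

/-! Up to the factors `1 / x`, every step from `G_l` to `G_{l+1}` is the single transform T f(x) =
∫₀¹ x/(1 - tx) f(t) dt: for even `l` the `t` in the kernel cancels the prefactor `1 / t`, and for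
odd `l` a factor `1 / x` comes out. On Taylor coefficients T sends (c_n) to ∑ c_n/(n + j) (`trans`).

Let D₀, D₁ denote integration from 0 against 1/t and 1/(1 - t) (`opZero`, `opOne`). Partial
fractions give T D₀ = const · L_[1] - D₀ T on series without constant term (`trans_opZero`) and T D₁
= (D₀ + D₁) T (`trans_opOne`). Adding them, the D₀ T terms cancel: T (D₀ + D₁) = const · L_[1] + D₁
T. The sums A_m of all admissible hyperlogarithms of weight m are built by applying D₁ and D₀ + D₁
alternately to 1, so T maps A_m to a combination of A_{m+1}, A_{m-1}, … (`trans_admCoeff`). Its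
coefficients are sums of values L_[b](1), identified with ψ in `psi_eq_admZeta`. Iterating T
produces the recursion for β (`sum_beta_succ`, `G_eq`).

That α agrees with β is purely combinatorial: the signed sum over X(i) cancels wherever a letter of
`a` is free, which leaves the indicator of admissibility (`sum_X_sign_admissible`, `alpha_eq`). -/

/-! ### Combinatorics of admissible words and of the sets X(i) -/

lemma mem_words {m : ℕ} {w : Word} : w ∈ words m ↔ w.length = m := by
  simp only [words, Finset.mem_image, Finset.mem_univ, true_and]
  constructor
  · rintro ⟨f, rfl⟩; simp
  · rintro rfl; exact ⟨w.get, List.ofFn_get w⟩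

lemma admissible_nil : Admissible [] := by simp [Admissible]

/-- Since positions are compared with the weight modulo 2, only the distance to the right end
matters, so a new first letter leaves the conditions on the tail unchanged. -/
lemma admissible_cons {a : Fin 2} {w : Word} :
    Admissible (a :: w) ↔ (a = 1 ∨ w.length % 2 = 1) ∧ Admissible w := by
  unfold Admissible
  constructor
  · intro h
    refine ⟨?_, fun k hk hp => ?_⟩
    · have := h 0 (by simp)
      simp only [List.length_cons, List.getElem?_cons_zero, Option.some.injEq] at this
      by_cases hw : w.length % 2 = 1
      · exact Or.inr hw
      · exact Or.inl (this (by omega))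
    · have := h (k + 1) (by simpa using hk)
      simp only [List.length_cons, List.getElem?_cons_succ] at this
      exact this (by omega)
  · rintro ⟨h1, h2⟩ k hk hp
    simp only [List.length_cons] at hk hp
    cases k with
    | zero =>
      rcases h1 with h1 | h1
      · simp [h1]
      · omega
    | succ k => simpa using h2 k (by omega) (by omega)

lemma Admissible.of_append {a b : Word} (h : Admissible (a ++ b)) : Admissible b := by
  induction a with
  | nil => simpa using h
  | cons x a ih => exact ih (admissible_cons.1 h).2

lemma Admissible.getLast? {w : Word} (h : Admissible w) (hw : w ≠ []) :
    w.getLast? = some 1 := by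
  have := h (w.length - 1) (by have := List.length_pos_of_ne_nil hw; omega)
    (by have := List.length_pos_of_ne_nil hw; congr 1; omega)
  rwa [List.getLast?_eq_getElem?]

lemma mem_endWords {m : ℕ} {w : Word} :
    w ∈ endWords m ↔ w.length = m ∧ w.getLast? = some 1 := by
  simp [endWords, mem_words]

lemma mem_admWords {m : ℕ} {w : Word} : w ∈ admWords m ↔ w.length = m ∧ Admissible w := by
  simp [admWords, mem_words]

lemma admWords_zero : admWords 0 = {[]} := by
  ext w
  simp only [mem_admWords, List.length_eq_zero_iff, Finset.mem_singleton, and_iff_left_iff_imp]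
  rintro rfl; exact admissible_nil

lemma admWords_eq_filter_endWords {m : ℕ} (hm : 1 ≤ m) :
    admWords m = (endWords m).filter Admissible := by
  ext w
  simp only [mem_admWords, Finset.mem_filter, mem_endWords]
  constructor
  · rintro ⟨rfl, h⟩
    exact ⟨⟨rfl, h.getLast? (by rintro rfl; simp at hm)⟩, h⟩
  · rintro ⟨⟨h1, -⟩, h2⟩; exact ⟨h1, h2⟩

lemma sum_admWords_succ {M : Type*} [AddCommMonoid M] (m : ℕ) (f : Word → M) :
    ∑ i ∈ admWords (m + 1), f i =
      ∑ i ∈ admWords m, ((if m % 2 = 1 then f (0 :: i) else 0) + f (1 :: i)) := by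
  have key : admWords (m + 1) =
      (if m % 2 = 1 then (admWords m).image (List.cons 0) else ∅) ∪
        (admWords m).image (List.cons 1) := by
    ext w
    cases w with
    | nil => split_ifs <;> simp [mem_admWords]
    | cons a w =>
      have ha : a = 0 ∨ a = 1 := by omega
      simp only [mem_admWords, admissible_cons, List.length_cons, add_left_inj, Finset.mem_union,
        Finset.mem_image, List.cons.injEq]
      rcases ha with rfl | rfl
      · split_ifs with h
        · simp only [Finset.mem_image, mem_admWords, List.cons.injEq]
          constructor
          · rintro ⟨rfl, -, h2⟩; exact Or.inl ⟨w, ⟨rfl, h2⟩, by simp⟩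
          · rintro (⟨v, ⟨rfl, h2⟩, -, rfl⟩ | ⟨v, -, h0, -⟩)
            · exact ⟨rfl, Or.inr h, h2⟩
            · simp at h0
        · simp only [Finset.notMem_empty, false_or]
          constructor
          · rintro ⟨rfl, h1 | h1, h2⟩
            · simp at h1
            · exact absurd h1 h
          · rintro ⟨v, -, h0, -⟩; simp at h0
      · split_ifs with h <;> simp [mem_admWords]
  rw [key, Finset.sum_union, Finset.sum_add_distrib, Finset.sum_image (by simp)]
  · congr 1
    split_ifs
    · rw [Finset.sum_image (by simp)]
    · simp
  · rw [Finset.disjoint_left]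
    intro w hw
    split_ifs at hw
    · simp only [Finset.mem_image] at hw ⊢
      rintro ⟨v, -, rfl⟩
      obtain ⟨u, -, hu⟩ := hw
      simp at hu
    · simp at hw

lemma mem_X {i a : Word} : a ∈ X i ↔ a.length = i.length - 1 ∧
    ∀ k < i.length - 1, i[k]? = some 1 → a[k]? = some 1 := by
  simp [X, mem_words]

lemma X_singleton (y : Fin 2) : X [y] = {[]} := by
  ext a; simp [mem_X, List.length_eq_zero_iff]

lemma cons_mem_X {y z : Fin 2} {i a : Word} (hi : i ≠ []) :
    z :: a ∈ X (y :: i) ↔ (y = 1 → z = 1) ∧ a ∈ X i := by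
  have hl := List.length_pos_of_ne_nil hi
  simp only [mem_X, List.length_cons, Nat.add_sub_cancel]
  constructor
  · rintro ⟨h1, h2⟩
    refine ⟨fun hy => ?_, by omega, fun k hk h => ?_⟩
    · simpa using h2 0 hl (by simpa using hy)
    · simpa using h2 (k + 1) (by omega) (by simpa using h)
  · rintro ⟨h1, h2, h3⟩
    refine ⟨by omega, fun k hk h => ?_⟩
    cases k with
    | zero => simpa using h1 (by simpa using h)
    | succ k => simpa using h3 k (by omega) (by simpa using h)

lemma sum_X_cons {M : Type*} [AddCommMonoid M] {y : Fin 2} {i : Word} (hi : i ≠ [])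
    (f : Word → M) :
    ∑ a ∈ X (y :: i), f a =
      ∑ a ∈ X i, ((if y = 0 then f (0 :: a) else 0) + f (1 :: a)) := by
  have hl := List.length_pos_of_ne_nil hi
  have key : X (y :: i) = (if y = 0 then (X i).image (List.cons 0) else ∅) ∪
      (X i).image (List.cons 1) := by
    ext w
    cases w with
    | nil => split_ifs <;> simp [mem_X] <;> omega
    | cons a w =>
      have ha : a = 0 ∨ a = 1 := by omega
      have hy : y = 0 ∨ y = 1 := by omega
      rw [cons_mem_X hi]
      rcases ha with rfl | rfl <;> rcases hy with rfl | rfl <;> simp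
  rw [key, Finset.sum_union, Finset.sum_add_distrib, Finset.sum_image (by simp)]
  · congr 1
    split_ifs
    · rw [Finset.sum_image (by simp)]
    · simp
  · rw [Finset.disjoint_left]
    intro w hw
    split_ifs at hw
    · simp only [Finset.mem_image] at hw ⊢
      rintro ⟨v, -, rfl⟩
      obtain ⟨u, -, hu⟩ := hw
      simp at hu
    · simp at hw

lemma sign_cons_one (a : Word) :
    (-1 : ℝ) ^ ((1 :: a).length - len (1 :: a)) = (-1) ^ (a.length - len a) := by
  simp [len]

lemma sign_cons_zero (a : Word) :
    (-1 : ℝ) ^ ((0 :: a).length - len (0 :: a)) = -(-1) ^ (a.length - len a) := by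
  have : a.count 1 ≤ a.length := List.count_le_length
  have h : (0 :: a).length - len (0 :: a) = (a.length - len a) + 1 := by
    simp [len]; omega
  rw [h, pow_succ]; ring

/-- Words in X(i) are one letter shorter than `i`, so a position that is forced in `i` is free in
`a`, and conversely. A zero of `i` at a forced position lets `a` have both letters there, with
opposite signs; at a free position of `i`, admissibility leaves only the letter 1, with sign +1. -/
lemma sum_X_sign_admissible {b : Word} (hb : b.length % 2 = 0) {i : Word}
    (hi : i.getLast? = some 1) :
    ∑ a ∈ X i, (-1 : ℝ) ^ (a.length - len a) * (if Admissible (a ++ b) then 1 else 0) =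
      if Admissible i ∧ Admissible b then 1 else 0 := by
  induction i with
  | nil => simp at hi
  | cons y i ih =>
    by_cases hn : i = []
    · subst hn
      have hy : y = 1 := by simpa using hi
      subst hy
      simp [X_singleton, admissible_cons, admissible_nil, len]
    · have hi' : i.getLast? = some 1 := by
        rw [← hi]; cases i with
        | nil => exact absurd rfl hn
        | cons z i => simp [List.getLast?_cons_cons]
      have hl := List.length_pos_of_ne_nil hn
      rw [sum_X_cons hn]
      simp only [sign_cons_one, sign_cons_zero, List.cons_append, admissible_cons]
      by_cases h : y = 0 ∧ i.length % 2 = 0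
      · obtain ⟨rfl, h⟩ := h
        rw [if_neg (by rintro ⟨⟨h1 | h1, -⟩, -⟩ <;> [simp at h1; omega])]
        -- Both choices of the first letter of `a` are allowed here, and their signs cancel.
        apply Finset.sum_eq_zero
        intro a ha
        have : (a.length + b.length) % 2 = 1 := by
          have := (mem_X.1 ha).1
          omega
        simp only [List.length_append, this, or_true, true_and]
        split_ifs <;> simp
      · have : (y = 1 ∨ i.length % 2 = 1) := by omega
        simp only [this, true_and, true_or]
        rw [← ih hi']
        apply Finset.sum_congr rfl
        intro a ha
        by_cases hy : y = 0
        · have : (a.length + b.length) % 2 = 0 := by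
            have := (mem_X.1 ha).1
            omega
          simp [List.length_append, this]
        · simp [hy]

/-- In odd weight the first position is forced to be 1. -/
lemma Admissible.length_even {b : Word} (hb : Admissible b) (h0 : b.head? = some 0) :
    b.length % 2 = 0 := by
  cases b with
  | nil => simp
  | cons a b =>
    have ha : a = 0 := by simpa using h0
    subst ha
    rcases (admissible_cons.1 hb).1 with h | h
    · simp at h
    · simp; omega

lemma beta_eq_zero {l m : ℕ} (h : ¬ (1 ≤ m ∧ m + 1 ≤ l ∧ m % 2 ≠ l % 2)) : beta l m = 0 := by
  match l with
  | 0 => rfl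
  | 1 => rfl
  | 2 =>
    rw [beta, if_neg]; rintro rfl; simp at h
  | l + 3 =>
    rw [beta, if_neg]; rintro ⟨h1, h2, h3⟩; apply h; omega

/-! ### The transform T on power series coefficients -/

/-- Effect on power series coefficients of integrating against `1/t`. -/
def opZero (c : ℕ → ℝ) (n : ℕ) : ℝ := c n / n

/-- Effect on power series coefficients of integrating against `1/(1-t)`. -/
def opOne (c : ℕ → ℝ) (n : ℕ) : ℝ := (∑ k ∈ Finset.range n, c k) / n

/-- The power series coefficients of the hyperlogarithm `L w`. -/
def coeff : Word → ℕ → ℝ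
  | [], n => if n = 0 then 1 else 0
  | a :: w, n => if a = 0 then opZero (coeff w) n else opOne (coeff w) n

/-- The power series coefficients of `∫ t in 0..1, x / (1 - t x) * ∑ n, c n t ^ n`. -/
def trans (c : ℕ → ℝ) (j : ℕ) : ℝ := if j = 0 then 0 else ∑' n, c n / (n + j)

/-- Division by zero yields 0, which is the correct constant term of a primitive vanishing at 0. -/
lemma coeff_cons_zero_index (a : Fin 2) (w : Word) : coeff (a :: w) 0 = 0 := by
  simp [coeff, opZero, opOne]

lemma coeff_nonneg (w : Word) (n : ℕ) : 0 ≤ coeff w n := by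
  induction w generalizing n with
  | nil => unfold coeff; split_ifs <;> simp
  | cons a w ih =>
    unfold coeff opZero opOne
    split_ifs
    · exact div_nonneg (ih n) (Nat.cast_nonneg n)
    · exact div_nonneg (Finset.sum_nonneg fun k _ => ih k) (Nat.cast_nonneg n)

lemma coeff_le_one (w : Word) (n : ℕ) : coeff w n ≤ 1 := by
  induction w generalizing n with
  | nil => unfold coeff; split_ifs <;> simp
  | cons a w ih =>
    rcases Nat.eq_zero_or_pos n with rfl | hn
    · rw [coeff_cons_zero_index]; exact zero_le_one
    have hn' : (1 : ℝ) ≤ n := by exact_mod_cast hn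
    unfold coeff opZero opOne
    split_ifs
    · rw [div_le_one (by linarith)]; exact (ih n).trans hn'
    · rw [div_le_one (by linarith)]
      calc ∑ k ∈ Finset.range n, coeff w k ≤ ∑ k ∈ Finset.range n, (1 : ℝ) :=
            Finset.sum_le_sum fun k _ => ih k
        _ = n := by simp

lemma hasSum_congr {ι : Type*} {f g : ι → ℝ} {s : ℝ} (h : ∀ i, f i = g i) :
    HasSum f s ↔ HasSum g s := by
  rw [funext h]

lemma hasSum_telescope (k j : ℕ) :
    HasSum (fun i : ℕ => 1 / ((k : ℝ) + i + 1) - 1 / ((k : ℝ) + i + 1 + j))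
      (∑ i ∈ Finset.range j, 1 / ((k : ℝ) + (i + 1 : ℕ))) := by
  induction j with
  | zero => simp
  | succ j ih =>
    rw [Finset.sum_range_succ]
    have h : HasSum (fun i : ℕ => 1 / ((k : ℝ) + i + 1 + j) - 1 / ((k : ℝ) + i + 1 + (j + 1 : ℕ)))
        (1 / ((k : ℝ) + (j + 1 : ℕ))) := by
      rw [hasSum_iff_tendsto_nat_of_nonneg]
      · have : ∀ n : ℕ, ∑ i ∈ Finset.range n,
            (1 / ((k : ℝ) + i + 1 + j) - 1 / ((k : ℝ) + i + 1 + (j + 1 : ℕ))) =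
            1 / ((k : ℝ) + (j + 1 : ℕ)) - 1 / ((k : ℝ) + (j + 1 : ℕ) + n) := by
          intro n
          induction n with
          | zero => simp
          | succ n ihn =>
            rw [Finset.sum_range_succ, ihn]
            push_cast
            ring
        simp only [this]
        have h0 : Filter.Tendsto (fun n : ℕ => 1 / ((k : ℝ) + (j + 1 : ℕ) + n)) Filter.atTop
            (nhds 0) := by
          simp only [one_div]
          exact tendsto_inv_atTop_zero.comp
            (Filter.tendsto_atTop_add_const_left _ _ tendsto_natCast_atTop_atTop)
        simpa using h0.const_sub (1 / ((k : ℝ) + (j + 1 : ℕ)))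
      · intro i
        rw [sub_nonneg]
        apply one_div_le_one_div_of_le
        · positivity
        · push_cast; linarith
    convert ih.add h using 1
    ext i; ring

/-- All the series defining `trans c` converge. -/
def TransSummable (c : ℕ → ℝ) : Prop := Summable fun n : ℕ => c n / ((n : ℝ) + 1)

lemma TransSummable.summable {c : ℕ → ℝ} (h : TransSummable c) (hc : ∀ n, 0 ≤ c n)
    {j : ℕ} (hj : 1 ≤ j) : Summable fun n : ℕ => c n / ((n : ℝ) + j) := by
  refine Summable.of_nonneg_of_le (fun n => div_nonneg (hc n) (by positivity)) (fun n => ?_) h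
  have : (1 : ℝ) ≤ j := by exact_mod_cast hj
  exact div_le_div_of_nonneg_left (hc n) (by positivity) (by linarith)

lemma TransSummable.summable_div {c : ℕ → ℝ} (h : TransSummable c) (hc : ∀ n, 0 ≤ c n) :
    Summable fun n : ℕ => c n / (n : ℝ) := by
  refine Summable.of_nonneg_of_le (fun n => div_nonneg (hc n) (by positivity)) (fun n => ?_)
    (h.mul_left 2)
  rcases Nat.eq_zero_or_pos n with rfl | hn
  · simp [hc 0]
  have hn' : (1 : ℝ) ≤ n := by exact_mod_cast hn
  rw [← mul_div_assoc, div_le_div_iff₀ (by linarith) (by linarith)]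
  nlinarith [hc n]

lemma TransSummable.opZero {c : ℕ → ℝ} (h : TransSummable c) (hc : ∀ n, 0 ≤ c n) :
    TransSummable (opZero c) := by
  refine Summable.of_nonneg_of_le
    (fun n => div_nonneg (div_nonneg (hc n) (by positivity)) (by positivity)) (fun n => ?_) h
  refine div_le_div_of_nonneg_right ?_ (by positivity)
  unfold IterInt.opZero
  rcases Nat.eq_zero_or_pos n with rfl | hn
  · simp [hc 0]
  · exact div_le_self (hc n) (by exact_mod_cast hn)

lemma hasSum_trans {c : ℕ → ℝ} (h : TransSummable c) (hc : ∀ n, 0 ≤ c n)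
    {j : ℕ} (hj : 1 ≤ j) : HasSum (fun n : ℕ => c n / ((n : ℝ) + j)) (trans c j) := by
  rw [trans, if_neg (by omega)]
  exact (h.summable hc hj).hasSum

/-- Partial fractions: 1/(n(n + j)) = (1/n - 1/(n + j))/j. The hypothesis `h0` disposes of the index
n = 0, where this identity fails. -/
lemma trans_opZero {c : ℕ → ℝ} (h : TransSummable c) (hc : ∀ n, 0 ≤ c n) (h0 : c 0 = 0) (j : ℕ) :
    trans (opZero c) j = (∑' n, c n / n) / j - opZero (trans c) j := by
  rcases Nat.eq_zero_or_pos j with rfl | hj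
  · simp [trans, IterInt.opZero]
  have h1 := ((h.summable_div hc).hasSum.sub (hasSum_trans h hc hj)).div_const (j : ℝ)
  rw [trans, if_neg (by omega), IterInt.opZero, ← sub_div, ← h1.tsum_eq]
  congr 1; ext n
  unfold IterInt.opZero
  rcases Nat.eq_zero_or_pos n with rfl | hn
  · simp [h0]
  · field_simp; ring

/-- The same partial fractions, followed by exchanging the sums over n and k < n. With n = k + i + 1
the sum over i telescopes (`hasSum_telescope`) to ∑_{1 ≤ i ≤ j} 1/(k + i). Nonnegativity justifies
the exchange. -/
lemma hasSum_opOne_div {c : ℕ → ℝ} (h : TransSummable c) (hc : ∀ n, 0 ≤ c n)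
    {j : ℕ} (hj : 1 ≤ j) :
    HasSum (fun n : ℕ => opOne c n / ((n : ℝ) + j))
      ((∑ i ∈ Finset.range j, trans c (i + 1)) / j) := by
  set f : ℕ × ℕ → ℝ := fun p => c p.1 * ((1 / ((p.1 : ℝ) + p.2 + 1) -
    1 / ((p.1 : ℝ) + p.2 + 1 + j)) / j) with hf
  have hinner : ∀ k : ℕ, HasSum (fun i => f (k, i))
      ((∑ i ∈ Finset.range j, c k / ((k : ℝ) + (i + 1 : ℕ))) / j) := by
    intro k
    have := ((hasSum_telescope k j).div_const (j : ℝ)).mul_left (c k)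
    rw [← mul_div_assoc, Finset.mul_sum] at this
    simpa only [mul_one_div] using this
  have houter : HasSum (fun k : ℕ => (∑ i ∈ Finset.range j, c k / ((k : ℝ) + (i + 1 : ℕ))) / j)
      ((∑ i ∈ Finset.range j, trans c (i + 1)) / j) :=
    (hasSum_sum fun i _ => hasSum_trans h hc (by omega)).div_const _
  have hnn : ∀ p, 0 ≤ f p := by
    intro p
    refine mul_nonneg (hc _) (div_nonneg (sub_nonneg.2 ?_) (by positivity))
    apply one_div_le_one_div_of_le
    · positivity
    · linarith [(Nat.cast_nonneg j : (0 : ℝ) ≤ j)]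
  have hsum : Summable f := by
    rw [summable_prod_of_nonneg hnn]
    refine ⟨fun k => (hinner k).summable, ?_⟩
    simp only [fun k => (hinner k).tsum_eq]
    exact houter.summable
  have htot : HasSum f ((∑ i ∈ Finset.range j, trans c (i + 1)) / j) := by
    have := hsum.hasSum.prod_fiberwise hinner
    rw [houter.unique this]
    exact hsum.hasSum
  -- Regrouping along k + i = n gives the term of index n + 1 of the original series; its term of
  -- index 0 vanishes.
  have h2 := (Finset.HasAntidiagonal.sigmaAntidiagonalEquivProd.hasSum_iff.2 htot).sigma
    (fun n => hasSum_fintype _)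
  rw [← hasSum_nat_add_iff' 1]
  simp only [Finset.range_one, Finset.sum_singleton, opOne, Nat.cast_zero, div_zero, zero_div,
    sub_zero]
  refine (hasSum_congr fun n => ?_).mpr h2
  change _ = ∑ b : { x // x ∈ Finset.HasAntidiagonal.antidiagonal n}, f b.1
  rw [Finset.sum_coe_sort (Finset.HasAntidiagonal.antidiagonal n) f, Finset.Nat.sum_antidiagonal_eq_sum_range_succ_mk,
    div_div, Finset.sum_div]
  apply Finset.sum_congr rfl
  intro k hk
  have hkn : (k : ℝ) + ((n - k : ℕ) : ℝ) = n := by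
    rw [← Nat.cast_add]; congr 1; have := Finset.mem_range.1 hk; omega
  have hj' : (0 : ℝ) < j := by exact_mod_cast hj
  simp only [hf, hkn]
  push_cast
  field_simp
  ring

lemma opOne_nonneg {c : ℕ → ℝ} (hc : ∀ n, 0 ≤ c n) (n : ℕ) : 0 ≤ opOne c n :=
  div_nonneg (Finset.sum_nonneg fun k _ => hc k) (Nat.cast_nonneg n)

lemma opZero_nonneg {c : ℕ → ℝ} (hc : ∀ n, 0 ≤ c n) (n : ℕ) : 0 ≤ opZero c n :=
  div_nonneg (hc n) (Nat.cast_nonneg n)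

lemma TransSummable.opOne {c : ℕ → ℝ} (h : TransSummable c) (hc : ∀ n, 0 ≤ c n) :
    TransSummable (opOne c) := by
  simpa [TransSummable] using (hasSum_opOne_div h hc le_rfl).summable

/-- The sum over 1 ≤ i ≤ j splits into its last term, which is the D₀ part, and the sum over i < j,
which is the D₁ part. The convention `trans c 0 = 0` makes the latter fit `opOne`. -/
lemma trans_opOne {c : ℕ → ℝ} (h : TransSummable c) (hc : ∀ n, 0 ≤ c n) (j : ℕ) :
    trans (opOne c) j = opZero (trans c) j + opOne (trans c) j := by
  rcases Nat.eq_zero_or_pos j with rfl | hj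
  · simp [trans, IterInt.opZero, IterInt.opOne]
  rw [trans, if_neg (by omega), (hasSum_opOne_div h hc hj).tsum_eq, IterInt.opZero, IterInt.opOne,
    ← add_div]
  congr 1
  obtain ⟨j, rfl⟩ := Nat.exists_eq_add_of_le' hj
  rw [Finset.sum_range_succ, Finset.sum_range_succ' (trans c)]
  simp [trans, add_comm]

lemma transSummable_coeff (w : Word) : TransSummable (coeff w) := by
  induction w with
  | nil =>
    apply summable_of_ne_finset_zero (s := {0})
    intro n hn
    simp [coeff, show n ≠ 0 by simpa using hn]
  | cons a w ih =>
    by_cases ha : a = 0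
    · convert ih.opZero (coeff_nonneg w) using 1
      ext n; simp [coeff, ha]
    · convert ih.opOne (coeff_nonneg w) using 1
      ext n; simp [coeff, ha]

/-! ### Termwise integration and Taylor series of hyperlogarithms -/

/-- Tonelli: for nonnegative terms, convergence of the series of integrals already forces
integrability of the sum. This is the source of the absolute convergence in the theorem. -/
lemma integrable_and_hasSum_integral {ι α : Type*} [Countable ι] [MeasurableSpace α]
    {μ : Measure α} {F : ι → α → ℝ} {f : α → ℝ} (hF : ∀ i, Integrable (F i) μ)
    (hnn : ∀ᵐ a ∂μ, ∀ i, 0 ≤ F i a) (hf : ∀ᵐ a ∂μ, HasSum (F · a) (f a))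
    (hs : Summable fun i => ∫ a, F i a ∂μ) :
    Integrable f μ ∧ HasSum (fun i => ∫ a, F i a ∂μ) (∫ a, f a ∂μ) := by
  have hnn' : ∀ i, 0 ≤ᵐ[μ] F i := fun i => hnn.mono fun a h => h i
  constructor
  · have hm : ∀ i, AEMeasurable (fun a => ENNReal.ofReal (F i a)) μ := fun i =>
      (hF i).1.aemeasurable.ennreal_ofReal
    have h1 : ∫⁻ a, ∑' i, ENNReal.ofReal (F i a) ∂μ ≠ ⊤ := by
      rw [lintegral_tsum hm]
      simp only [fun i => (ofReal_integral_eq_lintegral_ofReal (hF i) (hnn' i)).symm]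
      exact hs.tsum_ofReal_ne_top
    refine (integrable_toReal_of_lintegral_ne_top (AEMeasurable.tsum hm) h1).congr ?_
    filter_upwards [hnn, hf] with a h2 h3
    rw [← ENNReal.ofReal_tsum_of_nonneg h2 h3.summable, h3.tsum_eq,
      ENNReal.toReal_ofReal (h3.nonneg h2)]
  · have h1 : ∫ a, f a ∂μ = ∫ a, ∑' i, F i a ∂μ :=
      integral_congr_ae (hf.mono fun a h => h.tsum_eq.symm)
    rw [h1]
    refine hasSum_integral_of_summable_integral_norm hF ?_
    convert hs using 2 with i
    exact integral_congr_ae ((hnn' i).mono fun a h => Real.norm_of_nonneg h)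

/-- Termwise integration of a series of nonnegative monomials. -/
lemma integrable_and_hasSum_pow {ι : Type*} [Countable ι] {x : ℝ} (hx : 0 ≤ x) {a : ι → ℝ}
    {e : ι → ℕ} {f : ℝ → ℝ} (ha : ∀ i, 0 ≤ a i)
    (hf : ∀ t ∈ Set.Ioo 0 x, HasSum (fun i => a i * t ^ e i) (f t))
    (hs : Summable fun i => a i * (x ^ (e i + 1) / ((e i : ℝ) + 1))) :
    IntervalIntegrable f volume 0 x ∧
      HasSum (fun i => a i * (x ^ (e i + 1) / ((e i : ℝ) + 1))) (∫ t in (0 : ℝ)..x, f t) := by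
  have hint : ∀ i, ∫ t in Set.Ioo 0 x, a i * t ^ e i = a i * (x ^ (e i + 1) / ((e i : ℝ) + 1)) := by
    intro i
    rw [← integral_Ioc_eq_integral_Ioo, ← intervalIntegral.integral_of_le hx,
      intervalIntegral.integral_const_mul, integral_pow]
    simp
  rw [intervalIntegrable_iff_integrableOn_Ioo_of_le hx, intervalIntegral.integral_of_le hx,
    integral_Ioc_eq_integral_Ioo]
  simp only [← hint] at hs ⊢
  refine integrable_and_hasSum_integral (fun i => ?_) ?_ ?_ hs
  · have : IntervalIntegrable (fun t : ℝ => a i * t ^ e i) volume 0 x :=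
      Continuous.intervalIntegrable (by fun_prop) _ _
    rwa [intervalIntegrable_iff_integrableOn_Ioo_of_le hx] at this
  · filter_upwards [ae_restrict_mem measurableSet_Ioo] with t ht i
    exact mul_nonneg (ha i) (pow_nonneg ht.1.le _)
  · filter_upwards [ae_restrict_mem measurableSet_Ioo] with t ht
    exact hf t ht

lemma hasSum_integral_inv_mul {c : ℕ → ℝ} (hc : ∀ n, 0 ≤ c n) (h0 : c 0 = 0) {x : ℝ} (hx : 0 ≤ x)
    {f : ℝ → ℝ} (hf : ∀ t ∈ Set.Ioo 0 x, HasSum (fun n => c n * t ^ n) (f t))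
    (hs : Summable fun n => opZero c n * x ^ n) :
    HasSum (fun n => opZero c n * x ^ n) (∫ t in (0 : ℝ)..x, 1 / t * f t) := by
  rw [← hasSum_nat_add_iff' 1]
  rw [← summable_nat_add_iff 1] at hs
  have e : ∀ n : ℕ, opZero c (n + 1) * x ^ (n + 1) = c (n + 1) * (x ^ (n + 1) / ((n : ℝ) + 1)) := by
    intro n; unfold opZero; push_cast; ring
  simp only [e] at hs ⊢
  have := (integrable_and_hasSum_pow (e := fun n => n) (f := fun t => 1 / t * f t) hx
    (fun n => hc (n + 1)) (fun t ht => ?_) hs).2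
  · simpa [opZero, h0] using this
  · have h := hf t ht
    rw [← hasSum_nat_add_iff' 1] at h
    simp only [Finset.range_one, Finset.sum_singleton, h0, zero_mul, sub_zero] at h
    refine (hasSum_congr fun n => ?_).mpr (h.mul_left (1 / t))
    have := ht.1.ne'
    field_simp
    ring

/-- Cauchy product with the geometric series. -/
lemma hasSum_inv_one_sub_mul {c : ℕ → ℝ} (hc : ∀ n, 0 ≤ c n) {t : ℝ} (ht0 : 0 ≤ t) (ht1 : t < 1)
    {y : ℝ} (hf : HasSum (fun n => c n * t ^ n) y) :
    HasSum (fun n => (∑ k ∈ Finset.range (n + 1), c k) * t ^ n) (1 / (1 - t) * y) := by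
  have hg := hasSum_geometric_of_lt_one ht0 ht1
  have hnn : ∀ n, 0 ≤ c n * t ^ n := fun n => mul_nonneg (hc n) (pow_nonneg ht0 _)
  have h1 := summable_mul_of_summable_norm (hf.summable.norm) (hg.summable.norm)
  have h2 := (Finset.HasAntidiagonal.sigmaAntidiagonalEquivProd.hasSum_iff.2
    ((hf.mul hg h1))).sigma (fun n => hasSum_fintype _)
  rw [one_div, mul_comm]
  refine (hasSum_congr fun n => ?_).mpr h2
  change _ = ∑ b : { x // x ∈ Finset.HasAntidiagonal.antidiagonal n}, c b.1.1 * t ^ b.1.1 * t ^ b.1.2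
  rw [Finset.sum_coe_sort (Finset.HasAntidiagonal.antidiagonal n) (fun b => c b.1 * t ^ b.1 * t ^ b.2),
    Finset.Nat.sum_antidiagonal_eq_sum_range_succ_mk, Finset.sum_mul]
  apply Finset.sum_congr rfl
  intro k hk
  rw [mul_assoc, ← pow_add]
  congr 2
  have := Finset.mem_range.1 hk
  simp only; omega

lemma hasSum_integral_inv_one_sub_mul {c : ℕ → ℝ} (hc : ∀ n, 0 ≤ c n) {x : ℝ} (hx : 0 ≤ x)
    (hx1 : x ≤ 1)
    {f : ℝ → ℝ} (hf : ∀ t ∈ Set.Ioo 0 x, HasSum (fun n => c n * t ^ n) (f t))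
    (hs : Summable fun n => opOne c n * x ^ n) :
    HasSum (fun n => opOne c n * x ^ n) (∫ t in (0 : ℝ)..x, 1 / (1 - t) * f t) := by
  rw [← hasSum_nat_add_iff' 1]
  rw [← summable_nat_add_iff 1] at hs
  have e : ∀ n : ℕ, opOne c (n + 1) * x ^ (n + 1) =
      (∑ k ∈ Finset.range (n + 1), c k) * (x ^ (n + 1) / ((n : ℝ) + 1)) := by
    intro n; unfold opOne; push_cast; ring
  simp only [e] at hs ⊢
  have := (integrable_and_hasSum_pow (e := fun n => n) (f := fun t => 1 / (1 - t) * f t) hx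
    (fun n => Finset.sum_nonneg fun k _ => hc k)
    (fun t ht => hasSum_inv_one_sub_mul hc ht.1.le (ht.2.trans_le hx1) (hf t ht)) hs).2
  simpa [opOne] using this

lemma summable_coeff_mul_pow (w : Word) {x : ℝ} (hx : x ∈ Set.Ico (0 : ℝ) 1) :
    Summable fun n => coeff w n * x ^ n :=
  Summable.of_nonneg_of_le (fun n => mul_nonneg (coeff_nonneg w n) (pow_nonneg hx.1 n))
    (fun n => mul_le_of_le_one_left (pow_nonneg hx.1 n) (coeff_le_one w n))
    (summable_geometric_of_lt_one hx.1 hx.2)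

lemma coeff_cons_zero (w : Word) : coeff (0 :: w) = opZero (coeff w) := by
  ext n; simp [coeff]

lemma coeff_cons_one (w : Word) : coeff (1 :: w) = opOne (coeff w) := by
  ext n; simp [coeff]

lemma L_cons_zero (w : Word) (x : ℝ) : L (0 :: w) x = ∫ t in (0 : ℝ)..x, 1 / t * L w t := by
  simp [L, form]

lemma L_cons_one (w : Word) (x : ℝ) : L (1 :: w) x = ∫ t in (0 : ℝ)..x, 1 / (1 - t) * L w t := by
  simp [L, form]

lemma hasSum_L {w : Word} (hw : w = [] ∨ w.getLast? = some 1) {x : ℝ}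
    (hx : x ∈ Set.Ico (0 : ℝ) 1) : HasSum (fun n => coeff w n * x ^ n) (L w x) := by
  induction w generalizing x with
  | nil =>
    have := hasSum_single (f := fun n => coeff [] n * x ^ n) 0 (fun n hn => by simp [coeff, hn])
    simpa [coeff, L] using this
  | cons a w ih =>
    have hw' : w = [] ∨ w.getLast? = some 1 := by
      cases w with
      | nil => exact Or.inl rfl
      | cons b w => exact Or.inr (by simpa [List.getLast?_cons_cons] using hw)
    have hf : ∀ t ∈ Set.Ioo 0 x, HasSum (fun n => coeff w n * t ^ n) (L w t) :=
      fun t ht => ih hw' ⟨ht.1.le, ht.2.trans hx.2⟩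
    have hs := summable_coeff_mul_pow (a :: w) hx
    have ha : a = 0 ∨ a = 1 := by omega
    rcases ha with rfl | rfl
    -- The tail is nonempty because the word ends in 1, so its series has no constant term and the
    -- pole of 1/t does no harm.
    · obtain ⟨b, v, rfl⟩ : ∃ b v, w = b :: v := by
        cases w with
        | nil => simp at hw
        | cons b v => exact ⟨b, v, rfl⟩
      rw [coeff_cons_zero] at hs
      rw [coeff_cons_zero (b :: v), L_cons_zero]
      exact hasSum_integral_inv_mul (coeff_nonneg _) (coeff_cons_zero_index b v) hx.1 hf hs
    · rw [coeff_cons_one] at hs ⊢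
      rw [L_cons_one]
      exact hasSum_integral_inv_one_sub_mul (coeff_nonneg _) hx.1 hx.2.le hf hs

/-- At the endpoint 1 the expansion of `L w` is needed only inside the interval; convergence of ∑
c_n/n comes from `transSummable_coeff`. -/
lemma hasSum_L_cons_zero_one {w : Word} (hw : w.getLast? = some 1) :
    HasSum (fun n => coeff w n / n) (L (0 :: w) 1) := by
  have h0 : coeff w 0 = 0 := by
    cases w with
    | nil => simp at hw
    | cons b v => exact coeff_cons_zero_index b v
  have := hasSum_integral_inv_mul (f := L w) (coeff_nonneg w) h0 (zero_le_one)
    (fun t ht => hasSum_L (Or.inr hw) ⟨ht.1.le, ht.2⟩)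
    (by simpa [opZero] using (transSummable_coeff w).summable_div (coeff_nonneg w))
  rw [L_cons_zero]
  simpa [opZero] using this

/-- The integral transform `f ↦ ∫ t in 0..1, x / (1 - t x) * f t` on power series. -/
lemma integrable_and_hasSum_transform {c : ℕ → ℝ} (hc : ∀ n, 0 ≤ c n) (hT : TransSummable c)
    {f : ℝ → ℝ} (hf : ∀ t ∈ Set.Ioo (0 : ℝ) 1, HasSum (fun n => c n * t ^ n) (f t)) {x : ℝ}
    (hx : x ∈ Set.Ioo (0 : ℝ) 1) :
    IntervalIntegrable (fun t => x / (1 - t * x) * f t) volume 0 1 ∧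
      HasSum (fun j => trans c j * x ^ j) (∫ t in (0 : ℝ)..1, x / (1 - t * x) * f t) := by
  have hg := summable_geometric_of_lt_one hx.1.le hx.2
  -- Expanding x/(1 - tx) gives the monomials c_n x^{k+1} t^{k+n}. Dropping k from the denominator k
  -- + n + 1 bounds the integrated series by a product of two convergent ones; collecting by k
  -- afterwards gives `trans c (k + 1)`.
  have hs : Summable fun p : ℕ × ℕ => c p.2 * x ^ (p.1 + 1) *
      ((1 : ℝ) ^ (p.1 + p.2 + 1) / (((p.1 + p.2 : ℕ) : ℝ) + 1)) := by
    refine Summable.of_nonneg_of_le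
      (fun p => mul_nonneg (mul_nonneg (hc _) (pow_nonneg hx.1.le _)) (by positivity))
      (fun p => ?_) (summable_mul_of_summable_norm hg.norm (Summable.norm hT))
    have h1 : x ^ (p.1 + 1) ≤ x ^ p.1 := pow_le_pow_of_le_one hx.1.le hx.2.le (Nat.le_succ _)
    have h2 : c p.2 / (((p.1 + p.2 : ℕ) : ℝ) + 1) ≤ c p.2 / ((p.2 : ℝ) + 1) :=
      div_le_div_of_nonneg_left (hc _) (by positivity)
        (by push_cast; linarith [(Nat.cast_nonneg p.1 : (0 : ℝ) ≤ p.1)])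
    calc _ = x ^ (p.1 + 1) * (c p.2 / (((p.1 + p.2 : ℕ) : ℝ) + 1)) := by rw [one_pow]; ring
      _ ≤ _ := mul_le_mul h1 h2 (div_nonneg (hc _) (by positivity)) (pow_nonneg hx.1.le _)
  have hF : ∀ t ∈ Set.Ioo (0 : ℝ) 1, HasSum (fun p : ℕ × ℕ => c p.2 * x ^ (p.1 + 1) *
      t ^ (p.1 + p.2)) (x / (1 - t * x) * f t) := by
    intro t ht
    have htx0 : 0 ≤ t * x := mul_nonneg ht.1.le hx.1.le
    have htx : t * x < 1 := by nlinarith [ht.1, ht.2, hx.1, hx.2]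
    have h3 := (hasSum_geometric_of_lt_one htx0 htx).mul_left x
    have h4 := h3.mul (hf t ht) (summable_mul_of_summable_norm h3.summable.norm
      (hf t ht).summable.norm)
    rw [div_eq_mul_inv]
    refine (hasSum_congr fun p => ?_).mpr h4
    rw [mul_pow]; ring
  obtain ⟨h1, h2⟩ := integrable_and_hasSum_pow (x := 1) (f := fun t => x / (1 - t * x) * f t)
    (a := fun p : ℕ × ℕ => c p.2 * x ^ (p.1 + 1)) (e := fun p => p.1 + p.2)
    zero_le_one (fun p => mul_nonneg (hc _) (pow_nonneg hx.1.le _)) hF hs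
  refine ⟨h1, ?_⟩
  rw [← hasSum_nat_add_iff' 1]
  simp only [Finset.range_one, Finset.sum_singleton, trans, if_true, zero_mul, sub_zero]
  refine h2.prod_fiberwise fun j => ?_
  have := (hasSum_trans hT hc (Nat.le_add_left 1 j)).mul_right (x ^ (j + 1))
  rw [trans] at this
  refine (hasSum_congr fun n => ?_).mpr this
  simp only [one_pow]; push_cast; ring

/-! ### The transform of the admissible sums A_m -/

/-- The power series coefficients of the sum of all `L i`, `i` admissible of weight `m`. -/
def admCoeff (m n : ℕ) : ℝ := ∑ i ∈ admWords m, coeff i n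

/-- The sum of the values `L b 1` over the admissible words `b` of weight `2 p` that start with
`0`, and `1` for `p = 0`. -/
def admZeta (p : ℕ) : ℝ :=
  if p = 0 then 1 else ∑ b ∈ admWords (2 * p) with b.head? = some 0, L b 1

lemma opOne_sum {ι : Type*} (s : Finset ι) (a : ι → ℝ) (c : ι → ℕ → ℝ) (n : ℕ) :
    opOne (fun n => ∑ i ∈ s, a i * c i n) n = ∑ i ∈ s, a i * opOne (c i) n := by
  unfold opOne
  rw [Finset.sum_comm, Finset.sum_div]
  refine Finset.sum_congr rfl fun i _ => ?_
  rw [← Finset.mul_sum, mul_div_assoc]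

lemma opZero_sum {ι : Type*} (s : Finset ι) (a : ι → ℝ) (c : ι → ℕ → ℝ) (n : ℕ) :
    opZero (fun n => ∑ i ∈ s, a i * c i n) n = ∑ i ∈ s, a i * opZero (c i) n := by
  unfold opZero
  rw [Finset.sum_div]
  exact Finset.sum_congr rfl fun i _ => by ring

lemma admCoeff_nonneg (m n : ℕ) : 0 ≤ admCoeff m n :=
  Finset.sum_nonneg fun i _ => coeff_nonneg i n

lemma admCoeff_zero : admCoeff 0 = coeff [] := by
  ext n; simp [admCoeff, admWords_zero]

lemma transSummable_admCoeff (m : ℕ) : TransSummable (admCoeff m) := by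
  unfold TransSummable admCoeff
  simp only [Finset.sum_div]
  exact summable_sum fun i _ => transSummable_coeff i

lemma opOne_admCoeff (m n : ℕ) :
    opOne (admCoeff m) n = ∑ i ∈ admWords m, coeff (1 :: i) n := by
  have := opOne_sum (admWords m) (fun _ => 1) coeff n
  simp only [one_mul] at this
  simp only [coeff_cons_one]
  exact this

lemma opZero_admCoeff (m n : ℕ) :
    opZero (admCoeff m) n = ∑ i ∈ admWords m, coeff (0 :: i) n := by
  have := opZero_sum (admWords m) (fun _ => 1) coeff n
  simp only [one_mul] at this
  simp only [coeff_cons_zero]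
  exact this

/-- The first letter is forced to be 1 in odd weight and free in even weight, hence the alternation
of D₁ and D₀ + D₁. -/
lemma admCoeff_odd (p : ℕ) : admCoeff (2 * p + 1) = opOne (admCoeff (2 * p)) := by
  ext n
  rw [admCoeff, sum_admWords_succ, opOne_admCoeff]
  simp

lemma admCoeff_even (p : ℕ) : admCoeff (2 * p + 2) =
    opZero (admCoeff (2 * p + 1)) + opOne (admCoeff (2 * p + 1)) := by
  ext n
  rw [Pi.add_apply, admCoeff, sum_admWords_succ, opOne_admCoeff, opZero_admCoeff,
    ← Finset.sum_add_distrib]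
  simp

lemma admCoeff_odd_zero_index (p : ℕ) : admCoeff (2 * p + 1) 0 = 0 := by
  rw [admCoeff_odd]; simp [opOne]

lemma admCoeff_one (j : ℕ) : admCoeff 1 j = 1 / j := by
  rw [admCoeff_odd 0, mul_zero, admCoeff_zero]
  rcases j with _ | j
  · simp [opOne]
  · simp [opOne, coeff]

lemma admZeta_succ (p : ℕ) : admZeta (p + 1) = ∑' n : ℕ, admCoeff (2 * p + 1) n / n := by
  have h : ∀ i ∈ admWords (2 * p + 1), HasSum (fun n : ℕ => coeff i n / n) (L (0 :: i) 1) :=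
    fun i hi => by
      obtain ⟨h1, h2⟩ := mem_admWords.1 hi
      exact hasSum_L_cons_zero_one (h2.getLast? (by rintro rfl; simp at h1))
  rw [admZeta, if_neg (by omega), Finset.sum_filter, show 2 * (p + 1) = 2 * p + 1 + 1 by ring,
    sum_admWords_succ]
  simp only [admCoeff, Finset.sum_div]
  rw [(hasSum_sum h).tsum_eq]
  simp

lemma trans_add {c d : ℕ → ℝ} (hc : TransSummable c) (hd : TransSummable d) (hc0 : ∀ n, 0 ≤ c n)
    (hd0 : ∀ n, 0 ≤ d n) (j : ℕ) : trans (c + d) j = trans c j + trans d j := by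
  rcases Nat.eq_zero_or_pos j with rfl | hj
  · simp [trans]
  · rw [trans, if_neg (by omega), ← ((hasSum_trans hc hc0 hj).add (hasSum_trans hd hd0 hj)).tsum_eq]
    simp [add_div]

lemma trans_admCoeff_odd_of_even (p j : ℕ)
    (h : trans (admCoeff (2 * p)) = fun j =>
      ∑ n ∈ Finset.range (p + 1), admZeta n * admCoeff (2 * (p - n) + 1) j) :
    trans (admCoeff (2 * p + 1)) j =
      ∑ n ∈ Finset.range (p + 1), admZeta n * admCoeff (2 * (p - n) + 2) j := by
  rw [admCoeff_odd, trans_opOne (transSummable_admCoeff _) (admCoeff_nonneg _), h, opZero_sum,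
    opOne_sum, ← Finset.sum_add_distrib]
  refine Finset.sum_congr rfl fun n _ => ?_
  rw [admCoeff_even, Pi.add_apply]; ring

/-- Induction in steps of two: A_{2p+2} = (D₀ + D₁) A_{2p+1}, so T A_{2p+2} is a multiple of A_1
plus D₁ T A_{2p+1}, and D₁ raises each even-weight A in T A_{2p+1} to the next odd weight. -/
lemma trans_admCoeff_two_mul (p : ℕ) :
    trans (admCoeff (2 * p)) = fun j =>
      ∑ n ∈ Finset.range (p + 1), admZeta n * admCoeff (2 * (p - n) + 1) j := by
  induction p with
  | zero =>
    ext j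
    simp only [mul_zero, admCoeff_zero, zero_add, Finset.range_one, Finset.sum_singleton, admZeta,
      if_true, one_mul, Nat.sub_self, admCoeff_one, trans]
    rcases Nat.eq_zero_or_pos j with rfl | hj
    · simp
    · rw [if_neg (by omega), tsum_eq_single 0 (fun n hn => by simp [coeff, hn])]
      simp [coeff]
  | succ p ih =>
    ext j
    have h1 : trans (admCoeff (2 * p + 1)) = fun j =>
        ∑ n ∈ Finset.range (p + 1), admZeta n * admCoeff (2 * (p - n) + 2) j := by
      ext j; exact trans_admCoeff_odd_of_even p j ih
    have hs := transSummable_admCoeff (2 * p + 1)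
    have hn := admCoeff_nonneg (2 * p + 1)
    -- The cancellation of the two D₀ T terms is the `sub_add_cancel`; the constant left by
    -- `trans_opZero` becomes the summand n = p + 1, multiplying A_1.
    rw [show 2 * (p + 1) = 2 * p + 2 by ring, admCoeff_even,
      trans_add (hs.opZero hn) (hs.opOne hn) (opZero_nonneg hn) (opOne_nonneg hn),
      trans_opZero hs hn (admCoeff_odd_zero_index p), trans_opOne hs hn, ← admZeta_succ,
      ← add_assoc, sub_add_cancel, h1, opOne_sum, Finset.sum_range_succ _ (p + 1), Nat.sub_self, mul_zero,
      zero_add, admCoeff_one, mul_one_div, add_comm]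
    congr 1
    refine Finset.sum_congr rfl fun n hn => ?_
    have := Finset.mem_range.1 hn
    rw [show 2 * (p + 1 - n) + 1 = 2 * (p - n + 1) + 1 by omega, admCoeff_odd (p - n + 1)]
    rfl

lemma trans_admCoeff (m j : ℕ) : trans (admCoeff m) j =
    ∑ n ∈ Finset.range (m / 2 + 1), admZeta n * admCoeff (m + 1 - 2 * n) j := by
  obtain ⟨p, rfl | rfl⟩ := m.even_or_odd'
  · rw [trans_admCoeff_two_mul, Nat.mul_div_cancel_left p two_pos]
    refine Finset.sum_congr rfl fun n hn => ?_
    have := Finset.mem_range.1 hn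
    congr 2; omega
  · rw [trans_admCoeff_odd_of_even p j (trans_admCoeff_two_mul p), show (2 * p + 1) / 2 = p by omega]
    refine Finset.sum_congr rfl fun n hn => ?_
    have := Finset.mem_range.1 hn
    congr 2; omega

lemma hasSum_admCoeff (m : ℕ) {x : ℝ} (hx : x ∈ Set.Ico (0 : ℝ) 1) :
    HasSum (fun n => admCoeff m n * x ^ n) (∑ i ∈ admWords m, L i x) := by
  simp only [admCoeff, Finset.sum_mul]
  refine hasSum_sum fun i hi => hasSum_L ?_ hx
  by_cases h : i = []
  · exact Or.inl h
  · exact Or.inr ((mem_admWords.1 hi).2.getLast? h)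

lemma transform_admWords (m : ℕ) {x : ℝ} (hx : x ∈ Set.Ioo (0 : ℝ) 1) :
    IntervalIntegrable (fun t => x / (1 - t * x) * ∑ i ∈ admWords m, L i t) volume 0 1 ∧
    ∫ t in (0 : ℝ)..1, x / (1 - t * x) * ∑ i ∈ admWords m, L i t =
      ∑ n ∈ Finset.range (m / 2 + 1), admZeta n * ∑ i ∈ admWords (m + 1 - 2 * n), L i x := by
  obtain ⟨h1, h2⟩ := integrable_and_hasSum_transform (admCoeff_nonneg m) (transSummable_admCoeff m)
    (fun t ht => hasSum_admCoeff m ⟨ht.1.le, ht.2⟩) hx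
  refine ⟨h1, h2.unique ?_⟩
  simp only [trans_admCoeff, Finset.sum_mul, mul_assoc]
  exact hasSum_sum fun n _ => (hasSum_admCoeff _ ⟨hx.1.le, hx.2⟩).mul_left _

/-! ### Multiple zeta values and the numbers ψ -/

/-- The strictly increasing tuples of positive integers below `N`. -/
def chains (r N : ℕ) : Finset (Fin r → ℕ) :=
  (Fintype.piFinset fun _ => Finset.range N).filter fun k => StrictMono k ∧ ∀ j, 0 < k j

lemma mem_chains {r N : ℕ} {k : Fin r → ℕ} :
    k ∈ chains r N ↔ (∀ j, k j < N) ∧ StrictMono k ∧ ∀ j, 0 < k j := by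
  simp [chains]

lemma snoc_mem_chains {r N K : ℕ} {k : Fin r → ℕ} :
    (Fin.snoc k K : Fin (r + 1) → ℕ) ∈ chains (r + 1) N ↔ K < N ∧ 0 < K ∧ k ∈ chains r K := by
  simp only [mem_chains, Fin.forall_fin_succ', Fin.snoc_castSucc, Fin.snoc_last]
  constructor
  · rintro ⟨⟨-, h1⟩, h2, h3, h4⟩
    refine ⟨h1, h4, fun j => ?_, fun i j hij => ?_, h3⟩
    · simpa using h2 (Fin.castSucc_lt_last j)
    · simpa using h2 (Fin.castSucc_lt_castSucc_iff.2 hij)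
  · rintro ⟨h1, h2, h3, h4, h5⟩
    refine ⟨⟨fun j => (h3 j).trans h1, h1⟩, fun i j hij => ?_, h5, h2⟩
    induction j using Fin.lastCases with
    | last =>
      induction i using Fin.lastCases with
      | last => exact absurd hij (lt_irrefl _)
      | cast i => simpa using h3 i
    | cast j =>
      induction i using Fin.lastCases with
      | last => exact absurd hij (not_lt.2 (Fin.le_last _))
      | cast i => simpa using h4 (Fin.castSucc_lt_castSucc_iff.1 hij)

lemma sum_chains_succ (r N : ℕ) (f : (Fin (r + 1) → ℕ) → ℝ) :
    ∑ k ∈ chains (r + 1) N, f k =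
      ∑ K ∈ Finset.range N with 0 < K, ∑ k ∈ chains r K, f (Fin.snoc k K) := by
  rw [Finset.sum_sigma']
  refine Finset.sum_bij' (fun k _ => (⟨k (Fin.last r), Fin.init k⟩ : Σ _ : ℕ, Fin r → ℕ))
    (fun p _ => Fin.snoc p.2 p.1) ?_ ?_ ?_ ?_ ?_
  · intro k hk
    rw [← Fin.snoc_init_self k, snoc_mem_chains] at hk
    simp only [Finset.mem_sigma, Finset.mem_filter, Finset.mem_range]
    exact ⟨⟨hk.1, hk.2.1⟩, hk.2.2⟩
  · rintro ⟨K, k⟩ hk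
    simp only [Finset.mem_sigma, Finset.mem_filter, Finset.mem_range] at hk
    exact snoc_mem_chains.2 ⟨hk.1.1, hk.1.2, hk.2⟩
  · intro k _; exact Fin.snoc_init_self k
  · rintro ⟨K, k⟩ _; simp
  · intro k _; simp

lemma zetaWord_nil : zetaWord [] = [] := rfl

lemma zetaWord_concat (l : List ℕ) (a : ℕ) :
    zetaWord (l ++ [a]) = List.replicate (a - 1) 0 ++ 1 :: zetaWord l := by
  simp [zetaWord]

lemma coeff_replicate_zero (a : ℕ) (w : Word) (n : ℕ) :
    coeff (List.replicate a 0 ++ 1 :: w) n =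
      (∑ k ∈ Finset.range n, coeff w k) * (1 / (n : ℝ) ^ (a + 1)) := by
  induction a with
  | zero => simp [coeff, opOne, div_eq_mul_inv]
  | succ a ih =>
    rw [List.replicate_succ, List.cons_append, coeff_cons_zero, opZero, ih, pow_succ _ (a + 1)]
    rw [mul_div_assoc, div_div]

/-- Fixing the largest index K on the left corresponds to the Taylor coefficient of index K on the
right: each block `0^{a-1} 1` sums over smaller indices and divides by K^a. -/
lemma sum_chains {r : ℕ} (m : Fin r → ℕ) (hm : ∀ j, 1 ≤ m j) (N : ℕ) :
    ∑ k ∈ chains r (N + 1), ∏ j, 1 / ((k j : ℝ) ^ m j) =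
      ∑ n ∈ Finset.range (N + 1), coeff (zetaWord (List.ofFn m)) n := by
  induction r generalizing N with
  | zero =>
    have : chains 0 (N + 1) = {default} := by
      ext k; simp [mem_chains, Subsingleton.elim k default, Subsingleton.strictMono]
    rw [this, Finset.sum_range_succ']
    simp [zetaWord_nil, coeff]
  | succ r ih =>
    rw [sum_chains_succ, Finset.sum_filter]
    refine Finset.sum_congr rfl fun K _ => ?_
    rw [List.ofFn_succ', List.concat_eq_append, zetaWord_concat, coeff_replicate_zero,
      Nat.sub_add_cancel (hm _)]
    rcases K with _ | K
    · simp
    · rw [if_pos (Nat.succ_pos K), ← ih (fun j => m j.castSucc) (fun j => hm _), Finset.sum_mul]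
      refine Finset.sum_congr rfl fun k _ => ?_
      rw [Fin.prod_univ_castSucc]
      simp

/-- The finite sets of tuples with entries at most N exhaust the index set, and by `sum_chains` the
sums over them are partial sums of the coefficient series. All terms are nonnegative, so these bound
every finite sum. -/
lemma multiZeta_eq {r : ℕ} (m : Fin r → ℕ) (hm : ∀ j, 1 ≤ m j) {V : ℝ}
    (hV : HasSum (coeff (zetaWord (List.ofFn m))) V) : multiZeta m = V := by
  set F : {k : Fin r → ℕ // StrictMono k ∧ ∀ j, 0 < k j} → ℝ :=
    fun k => ∏ j, 1 / ((k.1 j : ℝ) ^ m j) with hF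
  have hnn : ∀ k, 0 ≤ F k := fun k => Finset.prod_nonneg fun j _ => by positivity
  set S : ℕ → Finset {k : Fin r → ℕ // StrictMono k ∧ ∀ j, 0 < k j} :=
    fun N => (chains r (N + 1)).subtype _ with hS
  have hsum : ∀ N, ∑ k ∈ S N, F k =
      ∑ n ∈ Finset.range (N + 1), coeff (zetaWord (List.ofFn m)) n := by
    intro N
    rw [← sum_chains m hm, hS]
    exact Finset.sum_subtype_of_mem (fun k : Fin r → ℕ => ∏ j, 1 / ((k j : ℝ) ^ m j))
      (fun k hk => (mem_chains.1 hk).2)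
  have hmem : ∀ N k, k ∈ S N ↔ ∀ j, k.1 j < N + 1 := fun N k => by
    simp only [hS, Finset.mem_subtype, mem_chains]
    exact ⟨fun h => h.1, fun h => ⟨h, k.2⟩⟩
  have hmono : Monotone S := fun N M h k hk => by
    rw [hmem] at hk ⊢
    exact fun j => (hk j).trans_le (by omega)
  have htop : Filter.Tendsto S Filter.atTop Filter.atTop := by
    refine Filter.tendsto_atTop_finset_of_monotone hmono fun k => ⟨∑ j, k.1 j, ?_⟩
    rw [hmem]
    exact fun j => Nat.lt_succ_of_le
      (Finset.single_le_sum (f := k.1) (fun i _ => Nat.zero_le _) (Finset.mem_univ j))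
  have hs : Summable F := by
    refine summable_of_sum_le hnn (c := V) fun u => ?_
    obtain ⟨N, hN⟩ := (htop.eventually_ge_atTop u).exists
    calc ∑ k ∈ u, F k ≤ ∑ k ∈ S N, F k := Finset.sum_le_sum_of_subset_of_nonneg hN
          fun k _ _ => hnn k
      _ ≤ V := by
        rw [hsum]; exact sum_le_hasSum _ (fun n _ => coeff_nonneg _ n) hV
  have h1 := (show Filter.Tendsto (fun s => ∑ k ∈ s, F k) Filter.atTop (nhds (∑' k, F k)) from
    hs.hasSum).comp htop
  have h2 := (Filter.tendsto_add_atTop_iff_nat 1).2 hV.tendsto_sum_nat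
  refine tendsto_nhds_unique h1 (h2.congr fun N => (hsum N).symm)

lemma hasSum_coeff_cons_zero {w : Word} (hw : w.getLast? = some 1) :
    HasSum (coeff (0 :: w)) (L (0 :: w) 1) := by
  rw [coeff_cons_zero]; exact hasSum_L_cons_zero_one hw

lemma length_zetaWord {l : List ℕ} (hl : ∀ a ∈ l, 1 ≤ a) : (zetaWord l).length = l.sum := by
  induction l using List.reverseRecOn with
  | nil => rfl
  | append_singleton l a ih =>
    have ha := hl a (by simp)
    rw [zetaWord_concat, List.sum_append, List.length_append, List.length_cons,
      ih fun b hb => hl b (by simp [hb])]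
    simp; omega

lemma zetaWord_injective {l l' : List ℕ} (hl : ∀ a ∈ l, 1 ≤ a) (hl' : ∀ a ∈ l', 1 ≤ a)
    (h : zetaWord l = zetaWord l') : l = l' := by
  have key : ∀ (a b : ℕ) (v w : Word), List.replicate a (0 : Fin 2) ++ 1 :: v =
      List.replicate b 0 ++ 1 :: w → a = b ∧ v = w := by
    intro a
    induction a with
    | zero =>
      intro b v w h
      cases b with
      | zero => simpa using h
      | succ b => simp [List.replicate_succ] at h
    | succ a ih =>
      intro b v w h
      cases b with
      | zero => simp [List.replicate_succ] at h
      | succ b =>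
        simp only [List.replicate_succ, List.cons_append, List.cons.injEq, true_and] at h
        obtain ⟨h1, h2⟩ := ih b v w h
        exact ⟨by rw [h1], h2⟩
  induction l using List.reverseRecOn generalizing l' with
  | nil =>
    cases l' using List.reverseRecOn with
    | nil => rfl
    | append_singleton l' b => rw [zetaWord_concat, zetaWord_nil] at h; simp at h
  | append_singleton l a ih =>
    cases l' using List.reverseRecOn with
    | nil => rw [zetaWord_concat, zetaWord_nil] at h; simp at h
    | append_singleton l' b =>
      rw [zetaWord_concat, zetaWord_concat] at h
      obtain ⟨h1, h2⟩ := key _ _ _ _ h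
      have ha := hl a (by simp)
      have hb := hl' b (by simp)
      rw [ih (fun c hc => hl c (by simp [hc])) (fun c hc => hl' c (by simp [hc])) h2,
        show a = b by omega]

/-- Of two adjacent positions one is forced, and so is the last one; hence every 0 is followed by a
1 and the word splits into blocks `1` and `01`. -/
lemma exists_zetaWord_eq {w : Word} (hw : Admissible w) :
    ∃ l : List ℕ, zetaWord l = w ∧ (∀ a ∈ l, 1 ≤ a ∧ a ≤ 2) ∧
      (w.head? = some 0 → l.getLast? = some 2) := by
  match w with
  | [] => exact ⟨[], rfl, by simp, by simp⟩
  | 1 :: w =>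
    obtain ⟨l, h1, h2, -⟩ := exists_zetaWord_eq (admissible_cons.1 hw).2
    refine ⟨l ++ [1], by simp [zetaWord_concat, h1], ?_, by simp⟩
    intro a ha
    rcases List.mem_append.1 ha with ha | ha
    · exact h2 a ha
    · simp at ha; omega
  | [0] => simp [admissible_cons] at hw
  | 0 :: 0 :: w =>
    simp [admissible_cons] at hw; omega
  | 0 :: 1 :: w =>
    obtain ⟨l, h1, h2, -⟩ := exists_zetaWord_eq (admissible_cons.1 (admissible_cons.1 hw).2).2
    refine ⟨l ++ [2], by simp [zetaWord_concat, h1], ?_, by simp⟩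
    intro a ha
    rcases List.mem_append.1 ha with ha | ha
    · exact h2 a ha
    · simp at ha; omega

/-- Compositions into parts 1 and 2 with last part 2 and admissible word correspond, via `zetaWord`,
to the admissible words beginning with 0; each zeta value is the value at 1 of its hyperlogarithm.
-/
lemma psi_eq_admZeta (p : ℕ) : psi p = admZeta p := by
  unfold psi admZeta
  split_ifs with hp
  · rfl
  have hpos : ∀ c : Composition (2 * p), ∀ a ∈ c.blocks, 1 ≤ a := fun c a ha => c.blocks_pos ha
  have hhead : ∀ c : Composition (2 * p), c.blocks.getLast? = some 2 →
      ∃ w, zetaWord c.blocks = 0 :: 1 :: w := by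
    intro c hc
    obtain ⟨l, hl⟩ := List.getLast?_eq_some_iff.1 hc
    exact ⟨zetaWord l, by rw [hl, zetaWord_concat]; rfl⟩
  refine Finset.sum_bij (fun c _ => zetaWord c.blocks) ?_ ?_ ?_ ?_
  · intro c hc
    obtain ⟨h1, h2, h3⟩ := (Finset.mem_filter.1 hc).2
    obtain ⟨w, hw⟩ := hhead c h1
    rw [Finset.mem_filter, mem_admWords, length_zetaWord (hpos c), c.blocks_sum]
    exact ⟨⟨rfl, h3⟩, by rw [hw]; rfl⟩
  · intro c _ c' _ h
    exact Composition.ext (zetaWord_injective (hpos c) (hpos c') h)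
  · intro b hb
    obtain ⟨hb1, hb2⟩ := Finset.mem_filter.1 hb
    obtain ⟨hlen, hadm⟩ := mem_admWords.1 hb1
    obtain ⟨l, h1, h2, h3⟩ := exists_zetaWord_eq hadm
    refine ⟨⟨l, fun {a} ha => (h2 a ha).1, ?_⟩, ?_, h1⟩
    · rw [← length_zetaWord fun a ha => (h2 a ha).1, h1, hlen]
    · simp only [Finset.mem_filter, Finset.mem_univ, true_and]
      exact ⟨h3 hb2, fun a ha => (h2 a ha).2, h1 ▸ hadm⟩
  · intro c hc
    obtain ⟨h1, h2, h3⟩ := (Finset.mem_filter.1 hc).2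
    obtain ⟨w, hw⟩ := hhead c h1
    refine multiZeta_eq _ (fun j => c.one_le_blocksFun j) ?_
    rw [Composition.ofFn_blocksFun]
    rw [hw] at h3 ⊢
    exact hasSum_coeff_cons_zero ((admissible_cons.1 h3).2.getLast? (by simp))

/-! ### The coefficients α and β -/

/-- The recursion needs no parity condition: for `m` of the wrong parity every summand vanishes. -/
lemma beta_succ {l m : ℕ} (h1 : 1 ≤ m) (h2 : m ≤ l + 2) :
    beta (l + 3) m =
      ∑ n ∈ Finset.range ((l + 2 - m) / 2 + 1), admZeta n * beta (l + 2) (m - 1 + 2 * n) := by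
  rw [beta]
  simp only [psi_eq_admZeta]
  split_ifs with h
  · rfl
  · refine (Finset.sum_eq_zero fun n _ => ?_).symm
    rw [beta_eq_zero (by omega), mul_zero]

lemma sum_Icc_two_even {f : ℕ → ℝ} (hf : ∀ n, n % 2 = 1 → f n = 0) (N : ℕ) :
    ∑ n ∈ Finset.Icc 2 N, f n = ∑ k ∈ Finset.range (N / 2), f (2 * (k + 1)) := by
  rw [← Finset.sum_image (f := f) (g := fun k => 2 * (k + 1)) (by intro a _ b _ h; simp at h; omega)]
  symm
  apply Finset.sum_subset
  · intro n hn
    obtain ⟨k, hk, rfl⟩ := Finset.mem_image.1 hn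
    have := Finset.mem_range.1 hk
    exact Finset.mem_Icc.2 (by omega)
  · intro n hn hn'
    apply hf
    have := Finset.mem_Icc.1 hn
    by_contra h
    exact hn' (Finset.mem_image.2 ⟨n / 2 - 1, Finset.mem_range.2 (by omega), by omega⟩)

lemma sum_X_sign_mul {i b : Word} (hi : i.getLast? = some 1)
    (hb : b.length % 2 = 0 ∨ b.head? = some 0) (β : ℝ) :
    ∑ a ∈ X i, (-1) ^ (a.length - len a) * (if Admissible (a ++ b) then β else 0) =
      if Admissible i ∧ Admissible b then β else 0 := by
  by_cases hb' : b.length % 2 = 0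
  · have := congrArg (· * β) (sum_X_sign_admissible hb' hi)
    simpa [Finset.sum_mul, mul_assoc, ite_mul] using this
  · have hnb : ¬ Admissible b := fun h => hb' (h.length_even (hb.resolve_left hb'))
    rw [if_neg fun h => hnb h.2]
    exact Finset.sum_eq_zero fun a _ => by rw [if_neg fun h => hnb h.of_append, mul_zero]

/-- By induction the inner coefficients depend only on weight and admissibility, so each signed sum
over X(i) collapses. What remains is the recursion for β: the double sum supplies the terms n ≥ 1,
odd weights of `b` contributing nothing, and the sum without `b` supplies n = 0. -/
lemma alpha_eq (l : ℕ) {m : ℕ} (hm1 : 1 ≤ m) (hml : m ≤ l + 1) {i : Word} (hi : i ∈ endWords m) :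
    alpha (l + 2) i = if Admissible i then beta (l + 2) m else 0 := by
  induction l generalizing m i with
  | zero =>
    obtain rfl : m = 1 := by omega
    obtain ⟨h1, h2⟩ := mem_endWords.1 hi
    obtain ⟨y, rfl⟩ := List.length_eq_one_iff.1 h1
    have hy : y = 1 := by simpa using h2
    subst hy
    simp [alpha, beta, admissible_cons, admissible_nil]
  | succ l ih =>
    obtain ⟨hlen, hlast⟩ := mem_endWords.1 hi
    have hsecond : ∑ a ∈ X i ∩ endWords (i.length - 1),
        (-1) ^ (a.length - len a) * alpha (l + 2) a =
        if Admissible i then beta (l + 2) (m - 1) else 0 := by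
      rcases Nat.lt_or_ge 1 m with hm | hm
      · have h := sum_X_sign_mul hlast (b := []) (Or.inl rfl) (beta (l + 2) (m - 1))
        simp only [List.append_nil, admissible_nil, and_true] at h
        rw [← h]
        refine (Finset.sum_congr rfl fun a ha => ?_).trans
          (Finset.sum_subset Finset.inter_subset_left fun a ha ha' => ?_)
        · rw [ih (m := m - 1) (by omega) (by omega) (hlen ▸ (Finset.mem_inter.1 ha).2)]
        · rw [if_neg, mul_zero]
          intro hadm
          have hla := (mem_X.1 ha).1
          refine ha' (Finset.mem_inter.2 ⟨ha, mem_endWords.2 ⟨hla, hadm.getLast? ?_⟩⟩)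
          rintro rfl
          simp at hla; omega
      -- For m = 1 the only candidate is the empty word, which does not end in 1; this matches the
      -- value 0 of β at m = 0.
      · rw [beta_eq_zero (by omega), ite_self]
        refine Finset.sum_eq_zero fun a ha => ?_
        obtain ⟨h1, h2⟩ := mem_endWords.1 (Finset.mem_inter.1 ha).2
        rw [hlen, Nat.sub_eq_zero_of_le hm, List.length_eq_zero_iff] at h1
        subst h1
        simp at h2
    have hfirst : ∀ n ∈ Finset.Icc 2 (l + 2 - m),
        ∑ b ∈ endWords n with b.head? = some 0,
          L b 1 * ∑ a ∈ X i, (-1) ^ (a.length - len a) * alpha (l + 2) (a ++ b) =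
        if Admissible i then
          (∑ b ∈ admWords n with b.head? = some 0, L b 1) * beta (l + 2) (m - 1 + n) else 0 := by
      intro n hn
      obtain ⟨hn1, hn2⟩ := Finset.mem_Icc.1 hn
      have h : ∀ b ∈ endWords n, b.head? = some 0 →
          ∑ a ∈ X i, (-1) ^ (a.length - len a) * alpha (l + 2) (a ++ b) =
            if Admissible i ∧ Admissible b then beta (l + 2) (m - 1 + n) else 0 := by
        intro b hb hb0
        rw [← sum_X_sign_mul hlast (Or.inr hb0)]
        refine Finset.sum_congr rfl fun a ha => ?_
        obtain ⟨hb1, hb2⟩ := mem_endWords.1 hb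
        have hla := (mem_X.1 ha).1
        rw [ih (m := m - 1 + n) (by omega) (by omega)]
        refine mem_endWords.2 ⟨by rw [List.length_append]; omega, ?_⟩
        rw [List.getLast?_append, hb2]; rfl
      rw [Finset.sum_congr rfl fun b hb => by
        rw [h b (Finset.mem_filter.1 hb).1 (Finset.mem_filter.1 hb).2]]
      split_ifs with hadm
      · rw [admWords_eq_filter_endWords (by omega), Finset.filter_comm, Finset.sum_mul,
          Finset.sum_filter (p := Admissible)]
        refine Finset.sum_congr rfl fun b _ => ?_
        by_cases hb : Admissible b <;> simp [hadm, hb]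
      · simp [hadm]
    rw [alpha, hsecond, hlen, Finset.sum_congr rfl hfirst]
    split_ifs with hadm
    · rw [beta_succ hm1 hml, Finset.sum_range_succ', sum_Icc_two_even]
      · refine congrArg₂ (· + ·) (Finset.sum_congr rfl fun k _ => ?_) ?_
        · rw [admZeta, if_neg (by omega)]
        · simp [admZeta]
      · intro n hn
        rw [Finset.sum_eq_zero, zero_mul]
        intro b hb
        obtain ⟨h1, h2⟩ := Finset.mem_filter.1 hb
        obtain ⟨h3, h4⟩ := mem_admWords.1 h1
        have := h4.length_even h2
        omega
    · simp

/-! ### Induction on `l` for the functions G -/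

lemma integrable_and_integral_kernel_mul_G (l : ℕ) {x : ℝ} (hx : x ∈ Set.Ioo (0 : ℝ) 1)
    (C : ℝ) (s : Finset ℕ) (b : ℕ → ℝ)
    (h : ∀ t ∈ Set.Ioo (0 : ℝ) 1, kernel l t x * G l 1 t =
      C * ∑ m ∈ s, b m * (x / (1 - t * x) * ∑ i ∈ admWords m, L i t)) :
    IntervalIntegrable (fun t => kernel l t x * G l 1 t) volume 0 1 ∧
    ∫ t in (0 : ℝ)..1, kernel l t x * G l 1 t = C * ∑ m ∈ s, b m *
      ∑ n ∈ Finset.range (m / 2 + 1), admZeta n * ∑ i ∈ admWords (m + 1 - 2 * n), L i x := by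
  have hI : ∀ m ∈ s, IntervalIntegrable
      (fun t => b m * (x / (1 - t * x) * ∑ i ∈ admWords m, L i t)) volume 0 1 := fun m _ =>
    (transform_admWords m hx).1.const_mul (b m)
  constructor
  · have := (IntervalIntegrable.sum s hI).const_mul C
    rw [intervalIntegrable_iff_integrableOn_Ioo_of_le zero_le_one] at this ⊢
    refine this.congr_fun (fun t ht => ?_) measurableSet_Ioo
    simp only [h t ht, Finset.sum_apply]
  · have : ∫ t in (0 : ℝ)..1, kernel l t x * G l 1 t = ∫ t in (0 : ℝ)..1,
        C * ∑ m ∈ s, b m * (x / (1 - t * x) * ∑ i ∈ admWords m, L i t) := by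
      rw [intervalIntegral.integral_of_le zero_le_one, intervalIntegral.integral_of_le zero_le_one,
        integral_Ioc_eq_integral_Ioo, integral_Ioc_eq_integral_Ioo]
      exact setIntegral_congr_fun measurableSet_Ioo h
    rw [this, intervalIntegral.integral_const_mul, intervalIntegral.integral_finsetSum hI]
    congr 1
    refine Finset.sum_congr rfl fun m _ => ?_
    rw [intervalIntegral.integral_const_mul, (transform_admWords m hx).2]

/-- Collects the terms of the transformed sum by their new weight, substituting (m, n) ↦ (m + 1 -
2n, n). -/
lemma sum_beta_succ (l : ℕ) (S : ℕ → ℝ) :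
    ∑ m ∈ Finset.Icc 1 (l + 1), beta (l + 2) m *
      ∑ n ∈ Finset.range (m / 2 + 1), admZeta n * S (m + 1 - 2 * n) =
    ∑ m ∈ Finset.Icc 1 (l + 2), beta (l + 3) m * S m := by
  have h1 : ∑ m ∈ Finset.Icc 1 (l + 2), beta (l + 3) m * S m =
      ∑ m ∈ Finset.Icc 1 (l + 2), ∑ n ∈ Finset.range ((l + 2 - m) / 2 + 1),
        admZeta n * beta (l + 2) (m - 1 + 2 * n) * S m := by
    refine Finset.sum_congr rfl fun m hm => ?_
    obtain ⟨h1, h2⟩ := Finset.mem_Icc.1 hm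
    rw [beta_succ h1 h2, Finset.sum_mul]
  -- The vanishing term m = 0 is added so that the pair (1, 0) on the other side has a partner.
  have h2 : ∑ m ∈ Finset.Icc 1 (l + 1), beta (l + 2) m *
      ∑ n ∈ Finset.range (m / 2 + 1), admZeta n * S (m + 1 - 2 * n) =
      ∑ m ∈ Finset.range (l + 2), ∑ n ∈ Finset.range (m / 2 + 1),
        admZeta n * beta (l + 2) m * S (m + 1 - 2 * n) := by
    simp only [Finset.mul_sum]
    refine (Finset.sum_subset (fun m hm => ?_) fun m hm hm' => ?_).trans
      (Finset.sum_congr rfl fun m _ => Finset.sum_congr rfl fun n _ => by ring)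
    · have := Finset.mem_Icc.1 hm
      exact Finset.mem_range.2 (by omega)
    · rw [Finset.mem_Icc] at hm'
      have := Finset.mem_range.1 hm
      rw [beta_eq_zero (by omega)]
      simp
  rw [h1, h2, Finset.sum_sigma', Finset.sum_sigma']
  refine Finset.sum_bij' (fun p _ => (⟨p.1 + 1 - 2 * p.2, p.2⟩ : Σ _ : ℕ, ℕ))
    (fun p _ => ⟨p.1 - 1 + 2 * p.2, p.2⟩) ?_ ?_ ?_ ?_ ?_
  all_goals
    rintro ⟨m, n⟩ hp
    simp only [Finset.mem_sigma, Finset.mem_range, Finset.mem_Icc] at hp ⊢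
  · omega
  · omega
  · congr 1; omega
  · congr 1; omega
  · congr 3; omega

lemma G_eq (l : ℕ) {x : ℝ} (hx : x ∈ Set.Ioo (0 : ℝ) 1) :
    IntervalIntegrable (fun t => kernel (l + 1) t x * G (l + 1) 1 t) volume 0 1 ∧
    G (l + 2) 1 x = (if Odd (l + 1) then 1 / x else 1) *
      ∑ m ∈ Finset.Icc 1 (l + 1), beta (l + 2) m * ∑ i ∈ admWords m, L i x := by
  induction l generalizing x with
  | zero =>
    -- The constant `G_1 = 1` is A_0, a weight that β does not cover; hence the separate base case.
    obtain ⟨h1, h2⟩ := integrable_and_integral_kernel_mul_G 1 hx (1 / x) {0} (fun _ => 1)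
      (fun t ht => by
        have := hx.1.ne'
        simp only [kernel, G, Finset.sum_singleton, admWords_zero, L]
        rw [if_neg (by decide)]
        field_simp)
    refine ⟨h1, ?_⟩
    rw [G, h2]
    simp [admZeta, beta]
  | succ l ih =>
    obtain ⟨h1, h2⟩ := integrable_and_integral_kernel_mul_G (l + 2) hx
      (if Odd (l + 2) then 1 / x else 1) (Finset.Icc 1 (l + 1)) (beta (l + 2))
      (fun t ht => by
        have hx0 := hx.1.ne'
        have ht0 := ht.1.ne'
        rw [(ih ht).2, kernel]
        simp only [mul_left_comm (beta _ _), ← Finset.mul_sum]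
        rw [← mul_assoc, ← mul_assoc]
        congr 1
        -- In either parity, kernel times the prefactor of `G (l + 2) 1 t` equals x/(1 - tx) times
        -- the prefactor of the next function.
        by_cases hl : Even l
        · rw [if_pos (by simpa [Nat.even_add] using hl), if_pos (hl.add_one),
            if_neg (by simpa [Nat.odd_add, Nat.not_odd_iff_even] using hl)]
          field_simp
        · rw [if_neg (by simpa [Nat.even_add] using hl), if_neg (by simpa [Nat.odd_add_one] using hl),
            if_pos (by simpa [Nat.odd_add] using hl)]
          field_simp)
    refine ⟨h1, ?_⟩
    rw [G, h2, sum_beta_succ l fun m => ∑ i ∈ admWords m, L i x]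

end IterInt

end

theorem mainTheorem3 (l : ℕ) (hl : 1 ≤ l) :
    -- the shape of `G_{l+1}(1,x)`
    (∀ x ∈ Set.Ioo (0 : ℝ) 1,
      IntervalIntegrable (fun t => IterInt.kernel l t x * IterInt.G l 1 t)
        MeasureTheory.volume 0 1 ∧
      IterInt.G (l + 1) 1 x =
        (if Odd l then 1 / x else 1) *
          ∑ m ∈ Finset.Icc 1 l, IterInt.beta (l + 1) m *
            ∑ i ∈ IterInt.admWords m, IterInt.L i x) ∧
    -- its expansion with one coefficient for every word that ends in `1`
    (∀ x ∈ Set.Ioo (0 : ℝ) 1,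
      IterInt.G (l + 1) 1 x =
        (if Odd l then 1 / x else 1) *
          ∑ m ∈ Finset.Icc 1 l, ∑ i ∈ IterInt.endWords m,
            IterInt.alpha (l + 1) i * IterInt.L i x) ∧
    -- the coefficients depend only on the weight and vanish for non-admissible words
    (∀ m ∈ Finset.Icc 1 l, ∀ i ∈ IterInt.endWords m,
      IterInt.alpha (l + 1) i =
        if IterInt.Admissible i then IterInt.beta (l + 1) m else 0) := by
  obtain ⟨l, rfl⟩ := Nat.exists_eq_add_of_le' hl
  have hα : ∀ m ∈ Finset.Icc 1 (l + 1), ∀ i ∈ IterInt.endWords m,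
      IterInt.alpha (l + 1 + 1) i =
        if IterInt.Admissible i then IterInt.beta (l + 1 + 1) m else 0 := fun m hm i hi =>
    IterInt.alpha_eq l (Finset.mem_Icc.1 hm).1 (Finset.mem_Icc.1 hm).2 hi
  refine ⟨fun x hx => IterInt.G_eq l hx, fun x hx => ?_, hα⟩
  rw [(IterInt.G_eq l hx).2]
  congr 1
  refine Finset.sum_congr rfl fun m hm => ?_
  rw [IterInt.admWords_eq_filter_endWords (Finset.mem_Icc.1 hm).1, Finset.sum_filter,
    Finset.mul_sum]
  refine Finset.sum_congr rfl fun i hi => ?_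
  rw [hα m hm i hi]
  split_ifs <;> simp
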